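/- **AMPC model.** An adaptive massively parallel computation (AMPC) algorithm with I/O capacity $S$ on $N$ input bits has a finite set of machines and an arbitrary set of keys and values. For each $r$ there is a data store $\mathcal D_r$, a multiset of key-value pairs. Initially $\mathcal D_0=\{(i,x_i) : 1\le i\le N\}$. In round $r+1$ each machine adaptively queries keys in $\mathcal D_r$; the response to a query is the multiset of all values stored under that key, and later queries may depend on earlier responses. The machine then writes key-value pairs, as an arbitrary function of the responses it has received. $\mathcal D_{r+1}$ is the multiset of all pairs written in round $r+1$. For inputs promised to lie in $\Delta\subseteq\{0,1\}^N$ it is required that: - on every valid input $x\in\Delta$, for each machine in each round, the total number of values in all responses plus the number of queries with an empty response is at most $S$, and the machine writes at most $S$ pairs; - on every input $x\in\{0,1\}^N$, valid or not, in each round at most $S$ values (with multiplicity) are written under any single key. On an invalid input, a machine whose reads would exceed $S$ stops and writes nothing in that round. An $R$-round algorithm outputs $b\in\{0,1\}$ on $x$ if $\mathcal D_R$ consists of the single pair $(\text{ANSWER},b)$, where ANSWER is a fixed key different from the input keys. A randomized AMPC algorithm is a probability distribution over such deterministic algorithms; it uses at most $R$ rounds if almost every algorithm in the distribution does. It computes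 $g:\Delta\to\{0,1\}$ with error at most $\delta$ if for every $x\in\Delta$ it outputs $g(x)$ with probability at least $1-\delta$. **The 1-vs-2-cycle problem.** For even $n$, the input is an undirected graph on $n$ labelled vertices, given by $N=\binom n2$ bits saying which edges are present, and promised to be either a cycle of length $n$ (answer $1$) or two disjoint cycles of length $n/2$ each (answer $0$), where cycles have length at least $3$. **Theorem.** Let $n$ be even and let $S>1$ be real. Any randomized AMPC algorithm with I/O capacity $S$ that computes the 1-vs-2-cycle problem on $n$ vertices with error at most $1/6$ and uses at most $R$ rounds satisfies $$R\ \ge\ \tfrac16\log_S n-\tfrac12\log_S 2 .$$ Consequently $R=\Omega(\log_S n)$: there are absolute constants $c>0$ and $n_0$ such that $R\ge c\log_S n$ for all even $n\ge n_0$, all $S>1$ and all such algorithms. In particular, if $S=n^{\varepsilon}$ with $\varepsilon\in(0,1)$ then $R=\Omega(1/\varepsilon)$: there are absolute constants $c>0$ and $n_0$ (independent of $\varepsilon$ and $n$) such that $R\ge c/\varepsilon$ for all even $n\ge n_0$, all $\varepsilon\in(0,1)$ and all such algorithms. -/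

import Mathlib

open MeasureTheory

universe u v

/-- What a machine does in one round: a (well-founded) adaptive query tree. It either halts and
writes a multiset of key-value pairs, or queries a key and continues depending on the response,
which is the whole multiset of values stored under that key. -/
inductive QueryTree (K V : Type u) : Type u
  | halt (writes : Multiset (K × V)) : QueryTree K V
  | query (k : K) (next : Multiset V → QueryTree K V) : QueryTree K V

/-- The response to a query for the key `k`: the multiset of all values stored under `k` in a
distributed data store, which is a multiset of key-value pairs. -/
noncomputable def lookup {K V : Type u} (D : Multiset (K × V)) (k : K) : Multiset V := by
  classical exact (D.filter fun p => p.1 = k).map Prod.snd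

namespace QueryTree

variable {K V : Type u}

/-- The input cost of executing the tree against the store `D`: the total number of values in all
responses plus the number of queries with an empty response. -/
noncomputable def reads (D : Multiset (K × V)) : QueryTree K V → ℕ
  | halt _ => 0
  | query k next => max 1 (lookup D k).card + reads D (next (lookup D k))

/-- The pairs at the leaf that is reached when the tree is executed against the store `D`. -/
noncomputable def leafWrites (D : Multiset (K × V)) : QueryTree K V → Multiset (K × V)
  | halt w => w
  | query k next => leafWrites D (next (lookup D k))

/-- The pairs actually written under I/O capacity `S`: a machine whose input cost exceeds `S` is
stopped and writes nothing. -/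
noncomputable def writes (S : ℝ) (D : Multiset (K × V)) (t : QueryTree K V) :
    Multiset (K × V) := by
  classical exact if (t.reads D : ℝ) ≤ S then t.leafWrites D else 0

end QueryTree

/-- The code of a deterministic AMPC algorithm on input bits indexed by `ι`, with its own finite
set of machines and its own types of keys and values. `program r v` is what machine `v` does in
round `r + 1`; only `r < rounds` is used. -/
structure AMPCProgram (ι : Type) where
  Machine : Type u
  [fintypeMachine : Fintype Machine]
  Key : Type u
  Value : Type u
  inputKey : ι ↪ Key
  answerKey : Key
  inputKey_ne_answerKey : ∀ i, inputKey i ≠ answerKey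
  bit : Bool ↪ Value
  rounds : ℕ
  program : ℕ → Machine → QueryTree Key Value

namespace AMPCProgram

attribute [instance] AMPCProgram.fintypeMachine

variable {ι : Type} [Fintype ι]

/-- The contents `𝒟_r` of the distributed data store after round `r` on input `x`, under I/O
capacity `S`. `𝒟_0` holds the pairs `(i, x_i)`, and `𝒟_{r+1}` holds everything that the machines
write in round `r + 1`, in which they query `𝒟_r`. -/
noncomputable def store (P : AMPCProgram.{u} ι) (S : ℝ) (x : ι → Bool) :
    ℕ → Multiset (P.Key × P.Value)
  | 0 => (Finset.univ : Finset ι).val.map fun i => (P.inputKey i, P.bit (x i))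
  | r + 1 => ∑ m : P.Machine, (P.program r m).writes S (store P S x r)

end AMPCProgram

/-- A deterministic AMPC algorithm with I/O capacity `S` for inputs promised to lie in `Δ`.
On valid inputs every machine in every round reads within the capacity and writes at most `S`
pairs. On all inputs, valid or not, in every round at most `S` values are written under any key. -/
structure AMPCAlgorithm (S : ℝ) {ι : Type} [Fintype ι] (Δ : Set (ι → Bool)) extends
    AMPCProgram.{u} ι where
  reads_le : ∀ x ∈ Δ, ∀ r < rounds, ∀ m : Machine,
    ((program r m).reads (toAMPCProgram.store S x r) : ℝ) ≤ S
  writes_le : ∀ x ∈ Δ, ∀ r < rounds, ∀ m : Machine,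
    (((program r m).writes S (toAMPCProgram.store S x r)).card : ℝ) ≤ S
  values_le : ∀ x : ι → Bool, ∀ r < rounds, ∀ k : Key,
    ((lookup (toAMPCProgram.store S x (r + 1)) k).card : ℝ) ≤ S

/-- On input `x` the algorithm answers `b`: after the final round the store contains a single
key-value pair, `(answer, b)`. -/
def AMPCAlgorithm.Outputs {S : ℝ} {ι : Type} [Fintype ι] {Δ : Set (ι → Bool)}
    (A : AMPCAlgorithm.{u} S Δ) (x : ι → Bool) (b : Bool) : Prop :=
  A.store S x A.rounds = {(A.answerKey, A.bit b)}

/-- A randomized AMPC algorithm: a probability distribution over deterministic AMPC algorithms,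
given as a random deterministic algorithm on an arbitrary probability space. -/
structure RandomizedAMPC (S : ℝ) {ι : Type} [Fintype ι] (Δ : Set (ι → Bool)) where
  Ω : Type v
  [measurableSpace : MeasurableSpace Ω]
  μ : Measure Ω
  [isProbabilityMeasure : IsProbabilityMeasure μ]
  alg : Ω → AMPCAlgorithm.{u} S Δ
  measurableSet_outputs : ∀ x ∈ Δ, ∀ b : Bool, MeasurableSet {ω | (alg ω).Outputs x b}

namespace RandomizedAMPC

attribute [instance] RandomizedAMPC.measurableSpace RandomizedAMPC.isProbabilityMeasure

variable {S : ℝ} {ι : Type} [Fintype ι] {Δ : Set (ι → Bool)}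

/-- Almost every deterministic algorithm in the distribution uses at most `R` rounds (for a
discrete distribution: every algorithm in its support). -/
def RoundsAtMost (A : RandomizedAMPC.{u, v} S Δ) (R : ℕ) : Prop :=
  ∀ᵐ ω ∂A.μ, (A.alg ω).rounds ≤ R

/-- The algorithm computes the partial Boolean function `g : Δ → {0,1}` with error at most `δ`. -/
def ComputesWithError (A : RandomizedAMPC.{u, v} S Δ) (g : Δ → Bool) (δ : ℝ) : Prop :=
  ∀ x : Δ, 1 - δ ≤ A.μ.real {ω | (A.alg ω).Outputs x.1 (g x)}

end RandomizedAMPC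

/-- Positions of the `n.choose 2` input bits: unordered pairs of distinct vertices. -/
abbrev EdgeSlot (n : ℕ) : Type := {e : Sym2 (Fin n) // ¬ e.IsDiag}

/-- The undirected graph on `n` vertices described by the input bits. -/
def graphOfInput {n : ℕ} (x : EdgeSlot n → Bool) : SimpleGraph (Fin n) :=
  SimpleGraph.fromEdgeSet {e | ∃ h : ¬ e.IsDiag, x ⟨e, h⟩ = true}

/-- The graph is a single cycle of length `n`. -/
def IsOneCycle {n : ℕ} (G : SimpleGraph (Fin n)) : Prop :=
  3 ≤ n ∧ Nonempty (G ≃g SimpleGraph.cycleGraph n)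

/-- The graph consists of two disjoint cycles, each of length `n / 2`. -/
def IsTwoCycles {n : ℕ} (G : SimpleGraph (Fin n)) : Prop :=
  ∃ m : ℕ, 3 ≤ m ∧ n = 2 * m ∧
    Nonempty (G ≃g (SimpleGraph.cycleGraph m ⊕g SimpleGraph.cycleGraph m))

/-- The valid inputs of the 1-vs-2-cycle problem. -/
def cycleDomain (n : ℕ) : Set (EdgeSlot n → Bool) :=
  {x | IsOneCycle (graphOfInput x) ∨ IsTwoCycles (graphOfInput x)}

/-- The 1-vs-2-cycle problem: `1` on one-cycle instances and `0` on two-cycle instances. -/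
noncomputable def oneVsTwoCycle (n : ℕ) (x : cycleDomain n) : Bool := by
  classical exact decide (IsOneCycle (graphOfInput x.1))

/-! The proof is the polynomial method, with a clean handling of adaptivity. Every response `lookup
(store r) k` is a function of the input bits of degree at most `⌊S⌋₊ ^ (2 * r)`. A round multiplies
degrees by `⌊S⌋₊ ^ 2`: one factor because a machine can afford at most `⌊S⌋₊` queries
(`QueryTree.hasDegree_leafWrites`), another because at most `⌊S⌋₊` machines contribute to any one
key (`HasDegree.pi_of_sparse`). The number of machines never enters. The degree bound concerns
functions on the whole cube, so the limit on values per key must hold on invalid inputs too.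

On the other side, a two-layer cyclic graph of `2 * m` vertices is one cycle or two according to the
parity of its crossings. Starting from one crossing, flipping any of the `m` crossing bits turns one
cycle into two. A polynomial of degree `d` with values in `[0, 1]` can drop from `1` to `0` under
fewer than `4 * d ^ 2` such flips (`card_lt_four_mul_sq_of_sensitive`, by symmetrization and a
univariate jump bound). A randomized algorithm handles each flip correctly, together with the base
point, with probability at least `2 / 3`, so averaging gives `2 * m / 3 ≤ 4 * d ^ 2 - 1` with `d =
⌊S⌋₊ ^ (2 * R)`. -/

/-- The space of real functions on the Boolean cube that are polynomials of degree at most `d`. -/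
noncomputable def degreeLE (ι : Type) (d : ℕ) : Submodule ℝ ((ι → Bool) → ℝ) :=
  open Classical in Submodule.span ℝ {f | ∃ A : Finset ι, A.card ≤ d ∧
    f = fun x => if ∀ i ∈ A, x i = true then 1 else 0}

/-! ### Degree calculus for functions on the Boolean cube -/

section Degree

variable {ι : Type}

open Classical in
theorem monomial_mem_degreeLE {d : ℕ} {A : Finset ι} (hA : A.card ≤ d) :
    (fun x : ι → Bool => if ∀ i ∈ A, x i = true then (1 : ℝ) else 0) ∈ degreeLE ι d :=
  Submodule.subset_span ⟨A, hA, by congr! 3⟩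

/-- The monomial enters through its values rather than as an `if`, which keeps decidability
instances out of later arguments. -/
theorem degreeLE_induction {d : ℕ} {p : ((ι → Bool) → ℝ) → Prop} {f : (ι → Bool) → ℝ}
    (hf : f ∈ degreeLE ι d)
    (mon : ∀ A : Finset ι, A.card ≤ d →
      ∀ h : (ι → Bool) → ℝ, (∀ x, (∀ i ∈ A, x i = true) → h x = 1) →
        (∀ x, (¬ ∀ i ∈ A, x i = true) → h x = 0) → p h)
    (zero : p 0) (add : ∀ f g, p f → p g → p (f + g))
    (smul : ∀ (c : ℝ) f, p f → p (c • f)) : p f := by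
  refine Submodule.span_induction (p := fun f _ => p f) ?_ zero
    (fun f g _ _ => add f g) (fun c f _ => smul c f) hf
  rintro _ ⟨A, hA, rfl⟩
  exact mon A hA _ (fun x hx => if_pos hx) (fun x hx => if_neg hx)

theorem degreeLE_mono {d e : ℕ} (h : d ≤ e) : degreeLE ι d ≤ degreeLE ι e := by
  refine Submodule.span_mono ?_
  rintro f ⟨A, hA, rfl⟩
  exact ⟨A, hA.trans h, rfl⟩

theorem const_mem_degreeLE (c : ℝ) (d : ℕ) : (fun _ => c) ∈ degreeLE ι d := by
  classical
  have := (degreeLE ι d).smul_mem c (monomial_mem_degreeLE (ι := ι) (A := ∅) (Nat.zero_le d))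
  convert this using 1
  ext x
  simp

/-- Variables are idempotent on the cube, so the monomials of `A` and `B` multiply to that of `A ∪
B`. -/
theorem mul_mem_degreeLE {a b : ℕ} {f g : (ι → Bool) → ℝ}
    (hf : f ∈ degreeLE ι a) (hg : g ∈ degreeLE ι b) : f * g ∈ degreeLE ι (a + b) := by
  classical
  refine degreeLE_induction (p := fun f => f * g ∈ degreeLE ι (a + b)) hf ?_ ?_ ?_ ?_
  · intro A hA h h1 h0
    refine degreeLE_induction (p := fun g => h * g ∈ degreeLE ι (a + b)) hg ?_ ?_ ?_ ?_
    · intro B hB k k1 k0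
      have : h * k = fun x : ι → Bool => if ∀ i ∈ A ∪ B, x i = true then (1 : ℝ) else 0 := by
        ext x
        simp only [Pi.mul_apply, Finset.mem_union, or_imp, forall_and]
        by_cases hx : ∀ i ∈ A, x i = true
        · by_cases kx : ∀ i ∈ B, x i = true
          · rw [h1 x hx, k1 x kx, if_pos ⟨hx, kx⟩, one_mul]
          · rw [k0 x kx, if_neg fun h => kx h.2, mul_zero]
        · rw [h0 x hx, if_neg fun h => hx h.1, zero_mul]
      rw [this]
      exact monomial_mem_degreeLE ((Finset.card_union_le A B).trans (add_le_add hA hB))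
    · simp
    · intro f g hf hg
      rw [mul_add]
      exact add_mem hf hg
    · intro c f hf
      rw [mul_smul_comm]
      exact Submodule.smul_mem _ c hf
  · simp
  · intro f g hf hg
    rw [add_mul]
    exact add_mem hf hg
  · intro c f hf
    rw [smul_mul_assoc]
    exact Submodule.smul_mem _ c hf

/-- A function on the Boolean cube, with values in any type, has degree at most `d` if everything
that is determined by its value is a polynomial of degree at most `d`. -/
def HasDegree {α : Type*} (d : ℕ) (F : (ι → Bool) → α) : Prop :=
  ∀ g : α → ℝ, (fun x => g (F x)) ∈ degreeLE ι d

namespace HasDegree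

variable {α β : Type*} {a b d : ℕ}

theorem map {F : (ι → Bool) → α} (hF : HasDegree d F) (φ : α → β) :
    HasDegree d fun x => φ (F x) :=
  fun g => hF fun y => g (φ y)

theorem const (c : α) : HasDegree d fun _ : ι → Bool => c :=
  fun g => const_mem_degreeLE (g c) d

theorem mono {F : (ι → Bool) → α} (hF : HasDegree a F) (h : a ≤ b) : HasDegree b F :=
  fun g => degreeLE_mono h (hF g)

theorem coord (i : ι) : HasDegree 1 fun x : ι → Bool => x i := by
  classical
  intro g
  have h := add_mem (const_mem_degreeLE (ι := ι) (g false) 1)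
    ((degreeLE ι 1).smul_mem (g true - g false)
      (monomial_mem_degreeLE (ι := ι) (A := {i}) (d := 1) (by simp)))
  convert h using 1
  ext x
  cases hx : x i <;> simp [hx]

/-- This is adaptivity: split according to the value `c` of `F`, and multiply the indicator of `F x
= c` by the continuation for `c`. Degrees add once, however many values `c` there are. -/
theorem bind [Finite ι] {F : (ι → Bool) → α} {G : α → (ι → Bool) → β} (hF : HasDegree a F)
    (hG : ∀ c, HasDegree b (G c)) : HasDegree (a + b) fun x => G (F x) x := by
  classical
  have := Fintype.ofFinite ι
  intro g
  have h : (fun x => g (G (F x) x)) = ∑ c ∈ Finset.univ.image F,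
      (fun x => if F x = c then (1 : ℝ) else 0) * fun x => g (G c x) := by
    ext x
    simp [Finset.sum_apply]
  rw [h]
  exact sum_mem fun c _ => mul_mem_degreeLE (hF fun y => if y = c then 1 else 0) (hG c g)

theorem restrict [Finite ι] {J : Type*} [Zero α] [DecidableEq J] {F : J → (ι → Bool) → α}
    (hF : ∀ j, HasDegree d (F j)) (T : Finset J) :
    HasDegree (T.card * d) fun x j => if j ∈ T then F j x else 0 := by
  induction T using Finset.induction_on with
  | empty => simpa using const (d := 0) fun _ : J => (0 : α)
  | insert j T hj ih =>
    have h := (hF j).bind fun c => ih.map fun y => Function.update y j c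
    rw [Finset.card_insert_of_notMem hj, add_mul, one_mul, add_comm]
    convert h using 2 with x
    funext i
    by_cases hi : i = j
    · subst hi
      simp
    · simp [hi]

/-- A family of functions of degree `d` of which at most `s` are nonzero at every point has joint
degree at most `s * d`. -/
theorem pi_of_sparse [Finite ι] {J : Type*} [Fintype J] [Zero α] {F : J → (ι → Bool) → α} {s : ℕ}
    (hF : ∀ j, HasDegree d (F j))
    (hs : ∀ x, ∃ T : Finset J, T.card ≤ s ∧ ∀ j ∉ T, F j x = 0) :
    HasDegree (s * d) fun x j => F j x := by
  classical
  -- Any `g` can be replaced by a `p` that agrees with it on vectors of support at most `s` and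
  -- whose composite with `F` has low degree. The construction is inclusion-exclusion over supports.
  have key : ∀ (s : ℕ) (g : (J → α) → ℝ), ∃ p : (J → α) → ℝ,
      (fun x => p fun j => F j x) ∈ degreeLE ι (s * d) ∧
      ∀ y : J → α, (Finset.univ.filter fun j => y j ≠ 0).card ≤ s → p y = g y := by
    intro s
    induction s with
    | zero =>
      intro g
      refine ⟨fun _ => g 0, const_mem_degreeLE _ _, fun y hy => ?_⟩
      refine congrArg g (funext fun j => ?_)
      simp only [Nat.le_zero, Finset.card_eq_zero, Finset.filter_eq_empty_iff] at hy
      exact (not_not.1 (hy (Finset.mem_univ j))).symm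
    | succ s ih =>
      intro g
      obtain ⟨p, hp, hpg⟩ := ih g
      -- The term for `T` repairs the error `g - p` on vectors supported exactly on `T`. It sees
      -- only the `s + 1` coordinates in `T`, hence its degree.
      let q : Finset J → (J → α) → ℝ := fun T y =>
        (fun z => g z - p z) fun j => if j ∈ T then y j else 0
      refine ⟨p + ∑ T ∈ Finset.powersetCard (s + 1) Finset.univ, q T, ?_, fun y hy => ?_⟩
      · have h : (fun x => (p + ∑ T ∈ Finset.powersetCard (s + 1) Finset.univ, q T)
            fun j => F j x) = (fun x => p fun j => F j x) +
              ∑ T ∈ Finset.powersetCard (s + 1) Finset.univ, fun x => q T fun j => F j x := by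
          ext x
          simp [Finset.sum_apply]
        rw [h]
        refine add_mem (degreeLE_mono (Nat.mul_le_mul_right d s.le_succ) hp)
          (sum_mem fun T hT => ?_)
        rw [← (Finset.mem_powersetCard.1 hT).2]
        exact restrict hF T fun z => g z - p z
      · simp only [Pi.add_apply, Finset.sum_apply]
        -- If `T` is not the support of `y`, restricting `y` to `T` leaves at most `s` nonzero
        -- entries, where `p` is already exact.
        have hq : ∀ T ∈ Finset.powersetCard (s + 1) Finset.univ,
            T ≠ (Finset.univ.filter fun j => y j ≠ 0) → q T y = 0 := by
          intro T hT hne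
          have hle : (Finset.univ.filter fun j =>
              (if j ∈ T then y j else 0) ≠ 0).card ≤ s := by
            by_contra! hlt
            have hsub : (Finset.univ.filter fun j => (if j ∈ T then y j else 0) ≠ 0) ⊆ T := by
              intro j
              simp only [Finset.mem_filter, ne_eq, ite_eq_right_iff, Classical.not_imp]
              exact fun h => h.2.1
            have hsub' : (Finset.univ.filter fun j => (if j ∈ T then y j else 0) ≠ 0) ⊆
                Finset.univ.filter fun j => y j ≠ 0 := by
              intro j
              simp only [Finset.mem_filter, ne_eq, ite_eq_right_iff, Classical.not_imp]
              exact fun h => ⟨h.1, h.2.2⟩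
            have h1 := Finset.eq_of_subset_of_card_le hsub
              (by rw [(Finset.mem_powersetCard.1 hT).2]; omega)
            have h2 := Finset.eq_of_subset_of_card_le hsub' (by omega)
            exact hne (h1.symm.trans h2)
          simp only [q, hpg _ hle, sub_self]
        by_cases hc : (Finset.univ.filter fun j => y j ≠ 0).card = s + 1
        · rw [Finset.sum_eq_single_of_mem _
            (Finset.mem_powersetCard.2 ⟨Finset.subset_univ _, hc⟩) hq]
          have : (fun j => if j ∈ (Finset.univ.filter fun j => y j ≠ 0) then y j else 0) = y := by
            funext j
            by_cases hj : y j = 0 <;> simp [hj]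
          simp only [q, this]
          ring
        · rw [Finset.sum_eq_zero, add_zero, hpg y (by omega)]
          intro T hT
          refine hq T hT ?_
          rintro rfl
          exact hc (Finset.mem_powersetCard.1 hT).2
  intro g
  obtain ⟨p, hp, hpg⟩ := key s g
  convert hp using 2 with x
  obtain ⟨T, hT, h0⟩ := hs x
  refine (hpg _ ((Finset.card_le_card fun j hj => ?_).trans hT)).symm
  by_contra hjT
  exact (Finset.mem_filter.1 hj).2 (h0 j hjT)

end HasDegree

end Degree

/-! ### Degree growth along the rounds of an algorithm -/

section Simulation

variable {K V : Type u} {ι : Type}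

theorem lookup_zero (k : K) : lookup (0 : Multiset (K × V)) k = 0 := by
  simp [lookup]

theorem lookup_add (D E : Multiset (K × V)) (k : K) :
    lookup (D + E) k = lookup D k + lookup E k := by
  simp [lookup]

theorem lookup_sum {J : Type*} (T : Finset J) (D : J → Multiset (K × V)) (k : K) :
    lookup (∑ j ∈ T, D j) k = ∑ j ∈ T, lookup (D j) k := by
  classical
  induction T using Finset.induction_on with
  | empty => simp [lookup_zero]
  | insert j T hj ih => rw [Finset.sum_insert hj, Finset.sum_insert hj, lookup_add, ih]

theorem lookup_singleton (k : K) (w : V) : lookup {(k, w)} k = {w} := by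
  simp [lookup, Multiset.filter_singleton]

-- Each query costs at least `1`, even with an empty response, so a budget `s` allows at most `s`
-- nested applications of `HasDegree.bind`. Cutting off at the budget keeps the bound valid on every
-- input.
open Classical in
theorem QueryTree.hasDegree_leafWrites [Finite ι] {d : ℕ} {D : (ι → Bool) → Multiset (K × V)}
    (hD : ∀ k, HasDegree d fun x => lookup (D x) k) (t : QueryTree K V) (s : ℕ) :
    HasDegree (s * d) fun x => if t.reads (D x) ≤ s then t.leafWrites (D x) else 0 := by
  induction t generalizing s with
  | halt w => simpa [reads, leafWrites] using HasDegree.const w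
  | query k next ih =>
    cases s with
    | zero =>
      have h : ∀ x, ¬ (query k next).reads (D x) ≤ 0 := by
        intro x
        simp only [reads]
        have := le_max_left 1 (lookup (D x) k).card
        omega
      simpa [h] using HasDegree.const (0 : Multiset (K × V))
    | succ s =>
      -- After the response `c` the remaining budget is `s + 1 - max 1 c.card`, at most `s`. The
      -- outer test guards against truncated subtraction.
      have h := (hD k).bind (b := s * d) (G := fun c x =>
        if max 1 c.card ≤ s + 1 then
          (if (next c).reads (D x) ≤ s + 1 - max 1 c.card then (next c).leafWrites (D x) else 0)
        else 0) (fun c => by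
          by_cases hc : max 1 c.card ≤ s + 1
          · simp only [hc, if_true]
            refine (ih c _).mono (Nat.mul_le_mul_right d ?_)
            have := le_max_left 1 c.card
            omega
          · simpa only [hc, if_false] using HasDegree.const 0)
      rw [add_mul, one_mul, add_comm]
      convert h using 2 with x
      simp only [reads, leafWrites]
      rw [← ite_and]
      refine if_congr ?_ rfl rfl
      omega

theorem QueryTree.hasDegree_writes [Finite ι] {d : ℕ} {S : ℝ} (hS : 0 ≤ S)
    {D : (ι → Bool) → Multiset (K × V)}
    (hD : ∀ k, HasDegree d fun x => lookup (D x) k) (t : QueryTree K V) :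
    HasDegree (⌊S⌋₊ * d) fun x => t.writes S (D x) := by
  classical
  convert t.hasDegree_leafWrites hD ⌊S⌋₊ using 2 with x
  simp only [writes, Nat.le_floor_iff hS]

variable [Fintype ι]

theorem AMPCProgram.hasDegree_lookup_store_zero (P : AMPCProgram.{u} ι) (S : ℝ) (k : P.Key) :
    HasDegree 1 fun x => lookup (P.store S x 0) k := by
  classical
  by_cases hk : ∃ i, P.inputKey i = k
  · obtain ⟨i, rfl⟩ := hk
    convert (HasDegree.coord i).map fun b => ({P.bit b} : Multiset P.Value) using 2 with x
    simp only [store, lookup, Multiset.filter_map, Multiset.map_map, Function.comp_def,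
      P.inputKey.injective.eq_iff]
    rw [show (Finset.univ : Finset ι).val.filter (fun j => j = i) = {i} by
      rw [← Finset.filter_val, Finset.filter_eq' (b := i)]; simp]
    simp
  · convert HasDegree.const (0 : Multiset P.Value) using 2 with x
    simp only [store, lookup, Multiset.filter_map, Multiset.map_map, Function.comp_def]
    rw [Multiset.filter_eq_nil.2]
    · simp
    · exact fun i _ h => hk ⟨i, h⟩

/-- At most `⌊S⌋₊` values lie under `k`, so at most `⌊S⌋₊` machines write there at any given input.
The sum over all machines is therefore a function of a sparse family. -/
theorem AMPCAlgorithm.hasDegree_lookup_store {S : ℝ} (hS : 0 ≤ S) {Δ : Set (ι → Bool)}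
    (A : AMPCAlgorithm.{u} S Δ) (r : ℕ) (hr : r ≤ A.rounds) (k : A.Key) :
    HasDegree (⌊S⌋₊ ^ (2 * r)) fun x => lookup (A.store S x r) k := by
  classical
  induction r generalizing k with
  | zero => simpa using A.hasDegree_lookup_store_zero S k
  | succ r ih =>
    have hw : ∀ m : A.Machine, HasDegree (⌊S⌋₊ * ⌊S⌋₊ ^ (2 * r))
        fun x => lookup ((A.program r m).writes S (A.store S x r)) k := fun m =>
      ((A.program r m).hasDegree_writes hS fun k => ih (by omega) k).map fun w => lookup w k
    have hsum : ∀ x, lookup (A.store S x (r + 1)) k =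
        ∑ m : A.Machine, lookup ((A.program r m).writes S (A.store S x r)) k := by
      intro x
      rw [AMPCProgram.store, lookup_sum]
    have h := HasDegree.pi_of_sparse (s := ⌊S⌋₊) hw fun x => by
      refine ⟨Finset.univ.filter fun m =>
        lookup ((A.program r m).writes S (A.store S x r)) k ≠ 0, ?_, by simp⟩
      refine le_trans ?_ (Nat.le_floor (A.values_le x r (by omega) k))
      rw [hsum, Multiset.card_sum, Finset.card_eq_sum_ones, Finset.sum_filter]
      refine Finset.sum_le_sum fun m _ => ?_
      split_ifs with hm
      · exact Nat.one_le_iff_ne_zero.2 (by simpa using hm)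
      · exact Nat.zero_le _
    convert h.map fun y => ∑ m, y m using 1
    · ring
    · exact funext hsum

end Simulation

/-! ### A univariate jump bound from finite differences -/

section Polynomial

open Polynomial

/-- The sum telescopes: `2 / (4 * k ^ 2 - 1) = 1 / (2 * k - 1) - 1 / (2 * k + 1)`. That it stays
below `1` is what makes the jump bound work. -/
theorem sum_range_two_div_four_mul_sq_sub_one (d : ℕ) :
    ∑ j ∈ Finset.range d, 2 / (4 * ((j : ℝ) + 1) ^ 2 - 1) = 1 - 1 / (2 * (d : ℝ) + 1) := by
  induction d with
  | zero => simp
  | succ d ih =>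
    have h : (4 * ((d : ℝ) + 1) ^ 2 - 1) = (2 * d + 1) * (2 * d + 3) := by ring
    rw [Finset.sum_range_succ, ih, h]
    push_cast
    have : (2 * ((d : ℝ) + 1) + 1) = 2 * d + 3 := by ring
    rw [this]
    field_simp
    ring

theorem sum_range_two_mul_add_one_symm {f : ℕ → ℝ} {d : ℕ}
    (hf : ∀ j ≤ d, f (d - j) = f (d + j)) :
    ∑ k ∈ Finset.range (2 * d + 1), f k =
      f d + ∑ j ∈ Finset.range d, 2 * f (d + (j + 1)) := by
  rw [show 2 * d + 1 = (d + 1) + d by ring, Finset.sum_range_add, Finset.sum_range_succ,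
    ← Finset.sum_range_reflect]
  have h1 : ∀ j ∈ Finset.range d, f (d - 1 - j) = f (d + (j + 1)) := by
    intro j hj
    rw [← hf (j + 1) (Finset.mem_range.1 hj)]
    congr 1
    omega
  rw [Finset.sum_congr rfl h1, ← Finset.mul_sum]
  have h2 : ∀ j ∈ Finset.range d, f (d + 1 + j) = f (d + (j + 1)) := fun j _ => by
    congr 1
    ring
  rw [Finset.sum_congr rfl h2]
  ring

/-- A weak form of the Ehlich-Zeller and Rivlin-Cheney bound: a polynomial of degree at most `d`
with values in `[0, 1]` on the integers from `0` to `s` cannot jump from `0` to `1` at the start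
if `s` is at least `4 * d ^ 2`. -/
theorem Polynomial.lt_four_mul_sq_of_jump {q : ℝ[X]} {d s : ℕ} (hq : q.natDegree ≤ d)
    (hb : ∀ k ≤ s, q.eval (k : ℝ) ∈ Set.Icc (0 : ℝ) 1) (h : q.eval 0 - q.eval 1 = 1) :
    s < 4 * d ^ 2 := by
  by_contra! hs
  obtain ⟨p, hp⟩ : X - C (1 : ℝ) ∣ q - C (q.eval 1) := by
    rw [dvd_iff_isRoot]
    simp
  have hpe : ∀ x, (x - 1) * p.eval x = q.eval x - q.eval 1 := fun x => by
    have := congrArg (eval x) hp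
    simpa using this.symm
  have hp0 : p.eval 0 = -1 := by
    have := hpe 0
    linarith
  have hpne : p ≠ 0 := by
    rintro rfl
    simp at hp0
  have hdeg : p.natDegree + 1 ≤ d := by
    have h1 : (q - C (q.eval 1)).natDegree ≤ d := (natDegree_sub_C).trans_le hq
    rw [hp, natDegree_mul (X_sub_C_ne_zero 1) hpne, natDegree_X_sub_C] at h1
    omega
  -- At the integers from `0` to `2 * d`, `P` samples `p` at `4 * j ^ 2` with `j ≤ d`, all in the
  -- range where `q` is controlled. As `P` has degree below `2 * d`, its difference of order `2 * d`
  -- vanishes.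
  let P : ℝ[X] := p.comp (4 * (X - C (d : ℝ)) ^ 2)
  have hP : P.natDegree < 2 * d := by
    have h1 : (4 * (X - C (d : ℝ)) ^ 2 : ℝ[X]).natDegree ≤ 2 := by compute_degree
    have h2 : P.natDegree ≤ p.natDegree * 2 := natDegree_comp_le.trans (Nat.mul_le_mul_left _ h1)
    omega
  have hsum := congrFun (fwdDiff_iter_eq_zero_of_degree_lt hP) 0
  rw [fwdDiff_iter_eq_sum_shift] at hsum
  have hPe : ∀ x, P.eval x = p.eval (4 * (x - d) ^ 2) := fun x => by simp [P]
  simp only [hPe, zero_add, nsmul_eq_mul, mul_one, Pi.zero_apply, zsmul_eq_mul] at hsum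
  rw [sum_range_two_mul_add_one_symm] at hsum
  · have hpos : (0 : ℝ) < (2 * d).choose d := by
      exact_mod_cast Nat.choose_pos (by omega)
    -- The central term has size `(2 * d).choose d` since `p.eval 0 = -1`. The others have smaller
    -- or equal binomials and `|p| ≤ 1 / (4 * j ^ 2 - 1)`, so they cannot cancel it.
    have hmain : |((-1 : ℝ) ^ d * ((2 * d).choose d : ℝ))| ≤
        ∑ j ∈ Finset.range d, (2 * d).choose d * (2 / (4 * ((j : ℝ) + 1) ^ 2 - 1)) := by
      have h0 : ((-1 : ℝ) ^ d * ((2 * d).choose d : ℝ)) = ∑ j ∈ Finset.range d,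
          2 * (((-1) ^ (2 * d - (d + (j + 1))) * ((2 * d).choose (d + (j + 1))) : ℤ) *
            p.eval (4 * (((d + (j + 1) : ℕ) : ℝ) - d) ^ 2)) := by
        have : 2 * d - d = d := by omega
        rw [this] at hsum
        simp only [sub_self, ne_eq, OfNat.ofNat_ne_zero, not_false_eq_true, zero_pow, mul_zero,
          hp0] at hsum
        push_cast at hsum ⊢
        linarith
      rw [h0]
      refine (Finset.abs_sum_le_sum_abs _ _).trans (Finset.sum_le_sum fun j hj => ?_)
      have hj1 : (0 : ℝ) < 4 * ((j : ℝ) + 1) ^ 2 - 1 := by nlinarith [(j.cast_nonneg : (0 : ℝ) ≤ j)]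
      have hpj : |p.eval (4 * ((j : ℝ) + 1) ^ 2)| ≤ 1 / (4 * ((j : ℝ) + 1) ^ 2 - 1) := by
        have hjd : 4 * (j + 1) ^ 2 ≤ s :=
          (Nat.mul_le_mul_left 4 (Nat.pow_le_pow_left (Finset.mem_range.1 hj) 2)).trans hs
        have e := hpe (4 * ((j : ℝ) + 1) ^ 2)
        have b1 := hb _ hjd
        have b3 := hb 1 (by nlinarith)
        push_cast at b1 b3
        rw [le_div_iff₀ hj1, ← abs_of_pos hj1, ← abs_mul, mul_comm, e, abs_le]
        constructor <;> linarith [b1.1, b1.2, b3.1, b3.2]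
      have hc : (((2 * d).choose (d + (j + 1)) : ℕ) : ℝ) ≤ (2 * d).choose d := by
        have := Nat.choose_le_middle (d + (j + 1)) (2 * d)
        rw [Nat.mul_div_cancel_left d two_pos] at this
        exact_mod_cast this
      push_cast
      rw [add_sub_cancel_left, abs_mul, abs_mul, abs_mul, abs_pow, abs_neg, abs_one, one_pow,
        one_mul, Nat.abs_cast, abs_two]
      calc _ = ((2 * d).choose (d + (j + 1)) : ℝ) * (2 * |p.eval (4 * ((j : ℝ) + 1) ^ 2)|) := by
            ring
        _ ≤ _ := by
            refine mul_le_mul hc ?_ (by positivity) hpos.le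
            calc _ ≤ 2 * (1 / (4 * ((j : ℝ) + 1) ^ 2 - 1)) := by gcongr
              _ = _ := by ring
    rw [← Finset.mul_sum, sum_range_two_div_four_mul_sq_sub_one, abs_mul, abs_pow, abs_neg,
      abs_one, one_pow, one_mul, abs_of_pos hpos] at hmain
    have : (0 : ℝ) < 1 / (2 * (d : ℝ) + 1) := by positivity
    nlinarith
  · intro j hj
    have h1 : (2 * d).choose (d - j) = (2 * d).choose (d + j) := by
      rw [← Nat.choose_symm (by omega : d + j ≤ 2 * d)]
      congr 1
      omega
    have h2 : (-1 : ℤ) ^ (2 * d - (d - j)) = (-1) ^ (2 * d - (d + j)) := by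
      rw [show 2 * d - (d - j) = (2 * d - (d + j)) + 2 * j by omega, pow_add, pow_mul]
      simp
    rw [h1, h2, Nat.cast_sub hj]
    push_cast
    congr 2
    ring

end Polynomial

/-! ### From sensitivity to univariate polynomials -/

section Symmetrization

open Polynomial

theorem comp_mem_degreeLE {ι κ : Type} {d : ℕ} {f : (ι → Bool) → ℝ} (hf : f ∈ degreeLE ι d)
    {φ : (κ → Bool) → ι → Bool} (hφ : ∀ i, HasDegree 1 fun y => φ y i) :
    (fun y => f (φ y)) ∈ degreeLE κ d := by
  classical
  refine degreeLE_induction (p := fun f => (fun y => f (φ y)) ∈ degreeLE κ d) hf ?_ ?_ ?_ ?_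
  · intro A hA h h1 h0
    have key : ∀ A : Finset ι,
        (fun y => if ∀ i ∈ A, φ y i = true then (1 : ℝ) else 0) ∈ degreeLE κ A.card := by
      intro A
      induction A using Finset.induction_on with
      | empty => simpa using const_mem_degreeLE (ι := κ) 1 0
      | insert i A hi ih =>
        have := mul_mem_degreeLE (hφ i fun b => if b = true then 1 else 0) ih
        rw [Finset.card_insert_of_notMem hi, add_comm]
        convert this using 1
        ext y
        simp only [Finset.forall_mem_insert, Pi.mul_apply, ite_and]
        split_ifs <;> simp
    convert degreeLE_mono hA (key A) using 2 with y
    split_ifs with hy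
    exacts [h1 _ hy, h0 _ hy]
  · exact zero_mem _
  · exact fun f g hf hg => add_mem hf hg
  · exact fun c f hf => Submodule.smul_mem _ c hf

/-- Minsky-Papert symmetrization: the average of a polynomial over the `k`-element subsets of a
finite set of variables is a univariate polynomial in `k` of no larger degree. -/
theorem exists_polynomial_eval_eq_average {κ : Type} [DecidableEq κ] {d : ℕ}
    {f : (κ → Bool) → ℝ} (hf : f ∈ degreeLE κ d) (U : Finset κ) :
    ∃ q : ℝ[X], q.natDegree ≤ d ∧ ∀ k ≤ U.card,
      ∑ T ∈ U.powersetCard k, f (fun i => decide (i ∈ T)) =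
        (U.card.choose k : ℝ) * q.eval (k : ℝ) := by
  refine degreeLE_induction (p := fun f => ∃ q : ℝ[X], q.natDegree ≤ d ∧ ∀ k ≤ U.card,
      ∑ T ∈ U.powersetCard k, f (fun i => decide (i ∈ T)) =
        (U.card.choose k : ℝ) * q.eval (k : ℝ)) hf ?_ ?_ ?_ ?_
  · intro A hA h h1 h0
    have hh : ∀ T : Finset κ, h (fun i => decide (i ∈ T)) = if A ⊆ T then 1 else 0 := by
      intro T
      split_ifs with hT
      · exact h1 _ fun i hi => by simpa using hT hi
      · exact h0 _ fun hi => hT fun i hiA => by simpa using hi i hiA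
    simp only [hh, Finset.sum_boole]
    by_cases hAU : A ⊆ U
    · have hle := Finset.card_le_card hAU
      -- With `a = A.card` and `n = U.card`, the `k`-subsets of `U` containing `A` number `(n -
      -- a).choose (k - a)`, which is `n.choose k * k.choose a / n.choose a`. The falling factorial
      -- also gives the required zero when `k < a`.
      refine ⟨C (1 / (A.card.factorial * U.card.choose A.card : ℝ)) * descPochhammer ℝ A.card,
        (natDegree_C_mul_le _ _).trans ?_, fun k hk => ?_⟩
      · rwa [descPochhammer_natDegree]
      · rw [eval_mul, eval_C, descPochhammer_eval_eq_descFactorial,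
          Nat.descFactorial_eq_factorial_mul_choose]
        have hf : (A.card.factorial : ℝ) ≠ 0 := by exact_mod_cast A.card.factorial_ne_zero
        have hc : (U.card.choose A.card : ℝ) ≠ 0 := by exact_mod_cast (Nat.choose_pos hle).ne'
        rcases le_or_gt A.card k with hak | hak
        · rw [Finset.card_filter_powersetCard_subset A U k hAU hak]
          have := Nat.choose_mul (n := U.card) hak
          have h' : (U.card.choose k * k.choose A.card : ℝ) =
              U.card.choose A.card * (U.card - A.card).choose (k - A.card) := by
            exact_mod_cast this
          push_cast
          field_simp
          linarith
        · rw [Nat.choose_eq_zero_of_lt hak, Finset.filter_eq_empty_iff.2]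
          · simp
          · intro T hT hAT
            have := Finset.card_le_card hAT
            rw [(Finset.mem_powersetCard.1 hT).2] at this
            omega
    · refine ⟨0, by simp, fun k _ => ?_⟩
      rw [Finset.filter_eq_empty_iff.2]
      · simp
      · exact fun T hT hAT => hAU (hAT.trans (Finset.mem_powersetCard.1 hT).1)
  · exact ⟨0, by simp, by simp⟩
  · rintro f g ⟨p, hp, hpf⟩ ⟨q, hq, hqg⟩
    refine ⟨p + q, natDegree_add_le_of_degree_le hp hq, fun k hk => ?_⟩
    simp only [Pi.add_apply, Finset.sum_add_distrib, hpf k hk, hqg k hk, eval_add]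
    ring
  · rintro c f ⟨p, hp, hpf⟩
    refine ⟨C c * p, (natDegree_C_mul_le _ _).trans hp, fun k hk => ?_⟩
    simp only [Pi.smul_apply, smul_eq_mul, ← Finset.mul_sum, hpf k hk, eval_mul, eval_C]
    ring

/-- A Boolean function of degree at most `d` has fewer than `4 * d ^ 2` variables whose flip
changes its value from `1` at the all-zeros point to `0`. -/
theorem card_lt_four_mul_sq_of_sensitive {κ : Type} [DecidableEq κ] {d : ℕ}
    {f : (κ → Bool) → ℝ} (hf : f ∈ degreeLE κ d) (hb : ∀ y, f y ∈ Set.Icc (0 : ℝ) 1)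
    {U : Finset κ} (hd : 1 ≤ d) (h0 : f (fun _ => false) = 1)
    (h1 : ∀ i ∈ U, f (fun j => decide (j = i)) = 0) : U.card < 4 * d ^ 2 := by
  rcases U.eq_empty_or_nonempty with rfl | hU
  · rw [Finset.card_empty]
    positivity
  obtain ⟨q, hq, hqe⟩ := exists_polynomial_eval_eq_average hf U
  refine lt_four_mul_sq_of_jump hq (fun k hk => ?_) ?_
  · have hc : (0 : ℝ) < U.card.choose k := by exact_mod_cast Nat.choose_pos hk
    have h := hqe k hk
    have hl : 0 ≤ ∑ T ∈ U.powersetCard k, f (fun i => decide (i ∈ T)) :=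
      Finset.sum_nonneg fun T _ => (hb _).1
    have hu : ∑ T ∈ U.powersetCard k, f (fun i => decide (i ∈ T)) ≤ U.card.choose k := by
      refine (Finset.sum_le_sum fun T _ => (hb _).2).trans ?_
      simp
    rw [h] at hl hu
    exact ⟨nonneg_of_mul_nonneg_right hl hc, by nlinarith⟩
  · have e0 := hqe 0 (Nat.zero_le _)
    have e1 := hqe 1 hU.card_pos
    simp only [Finset.powersetCard_zero, Finset.sum_singleton, Finset.notMem_empty, decide_false,
      h0, Nat.choose_zero_right, Nat.cast_one, Nat.cast_zero, one_mul] at e0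
    rw [Finset.powersetCard_one, Finset.sum_map] at e1
    simp only [Function.Embedding.coeFn_mk, Finset.mem_singleton, Nat.choose_one_right,
      Nat.cast_one] at e1
    rw [Finset.sum_eq_zero h1] at e1
    have : (U.card : ℝ) ≠ 0 := by exact_mod_cast hU.card_pos.ne'
    have : q.eval 1 = 0 := by
      rcases mul_eq_zero.1 e1.symm with h | h
      · contradiction
      · exact h
    rw [this, ← e0, sub_zero]

end Symmetrization

/-! ### Layered graphs with many sensitive crossings -/

section Graphs

open SimpleGraph

theorem cycleGraph_adj_iff_eq_add_one {n : ℕ} [NeZero n] (hn : 3 ≤ n) {u v : Fin n} :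
    (cycleGraph n).Adj u v ↔ u ≠ v ∧ (v = u + 1 ∨ u = v + 1) := by
  obtain ⟨n, rfl⟩ := Nat.exists_eq_add_of_le' (show 2 ≤ n by omega)
  rw [cycleGraph_adj, sub_eq_iff_eq_add', sub_eq_iff_eq_add']
  constructor
  · refine fun h => ⟨?_, h.symm⟩
    rintro rfl
    simp at h
  · exact fun h => h.2.symm

/-- The graph that joins every vertex to its image under a map. -/
def successorGraph {V : Type*} (τ : V → V) : SimpleGraph V :=
  SimpleGraph.fromRel fun u v => v = τ u

theorem nonempty_iso_cycleGraph {V : Type*} {n : ℕ} [NeZero n] (hn : 3 ≤ n) {τ : V → V}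
    (e : V ≃ Fin n) (he : ∀ v, e (τ v) = e v + 1) :
    Nonempty (successorGraph τ ≃g cycleGraph n) := by
  refine ⟨⟨e, fun {u v} => ?_⟩⟩
  rw [cycleGraph_adj_iff_eq_add_one hn, ← he, ← he]
  simp [successorGraph]

theorem nonempty_iso_cycleGraph_sum {V : Type*} {n : ℕ} [NeZero n] (hn : 3 ≤ n) {τ : V → V}
    (e : V ≃ Fin n ⊕ Fin n) (he : ∀ v, e (τ v) = (e v).map (· + 1) (· + 1)) :
    Nonempty (successorGraph τ ≃g (cycleGraph n ⊕g cycleGraph n)) := by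
  refine ⟨⟨e, fun {u v} => ?_⟩⟩
  have h : ∀ a b : Fin n ⊕ Fin n, (cycleGraph n ⊕g cycleGraph n).Adj a b ↔
      a ≠ b ∧ (b = a.map (· + 1) (· + 1) ∨ a = b.map (· + 1) (· + 1)) := by
    rintro (a | a) (b | b) <;> simp [cycleGraph_adj_iff_eq_add_one hn]
  rw [h, ← he, ← he]
  simp [successorGraph]

/-- Connectedness separates the two cases. -/
theorem not_isOneCycle_of_isTwoCycles {n : ℕ} {G : SimpleGraph (Fin n)} (h : IsTwoCycles G) :
    ¬ IsOneCycle G := by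
  rintro ⟨hn, ⟨e⟩⟩
  obtain ⟨m, hm, rfl, ⟨e'⟩⟩ := h
  obtain ⟨m, rfl⟩ := Nat.exists_eq_add_of_le' (show 1 ≤ m by omega)
  have h1 : (cycleGraph (2 * (m + 1))).Connected := cycleGraph_connected (n := 2 * m + 1)
  exact not_connected_sum ((Iso.connected_iff (e.symm.trans e')).1 h1)

/-- The input bits that describe a graph. -/
noncomputable def inputOfGraph {n : ℕ} (G : SimpleGraph (Fin n)) : EdgeSlot n → Bool :=
  open Classical in fun e => decide (e.1 ∈ G.edgeSet)

theorem graphOfInput_inputOfGraph {n : ℕ} (G : SimpleGraph (Fin n)) :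
    graphOfInput (inputOfGraph G) = G := by
  ext u v
  simp only [graphOfInput, inputOfGraph, fromEdgeSet_adj, Set.mem_ofPred_eq, decide_eq_true_eq,
    mem_edgeSet, exists_prop, Sym2.mk_isDiag_iff]
  exact ⟨fun h => h.1.2, fun h => ⟨⟨h.ne, h⟩, h.ne⟩⟩

variable {m : ℕ} [NeZero m]

/-- Two layers of `m` vertices, where step `j` changes the layer if `x j` holds. -/
def layerStep (x : Fin m → Bool) (v : Bool × Fin m) : Bool × Fin m :=
  (v.1 ^^ x v.2, v.2 + 1)

/-- The vertices of the two layers, numbered consecutively. -/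
def layerEquiv (m : ℕ) : Bool × Fin m ≃ Fin (2 * m) :=
  (finTwoEquiv.symm.prodCongr (Equiv.refl _)).trans finProdFinEquiv

omit [NeZero m] in
theorem layerEquiv_val (b : Bool) (j : Fin m) :
    (layerEquiv m (b, j)).val = if b = true then j + m else j := by
  cases b <;> simp [layerEquiv, finTwoEquiv, finProdFinEquiv]

/-- The graph on two layers of `m` vertices in which step `j` is crossed if `x j` holds. -/
def layerGraph (x : Fin m → Bool) : SimpleGraph (Fin (2 * m)) :=
  successorGraph fun v => layerEquiv m (layerStep x ((layerEquiv m).symm v))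

theorem fin_val_add_one (j : Fin m) :
    ((j + 1 : Fin m) : ℕ) = if (j : ℕ) = m - 1 then 0 else (j : ℕ) + 1 := by
  obtain ⟨k, rfl⟩ := Nat.exists_eq_succ_of_ne_zero (NeZero.ne m)
  rw [Fin.val_add_one]
  simp [Fin.ext_iff]

/-- With the only crossing at the last step, the consecutive numbering of the layers already turns
the step into `v ↦ v + 1` modulo `2 * m`. -/
theorem isOneCycle_layerGraph (hm : 3 ≤ m) :
    IsOneCycle (layerGraph fun j : Fin m => decide (j.val = m - 1)) := by
  have : NeZero (2 * m) := ⟨by omega⟩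
  refine ⟨by omega, nonempty_iso_cycleGraph (by omega) (Equiv.refl _) fun v => ?_⟩
  obtain ⟨⟨b, j⟩, rfl⟩ := (layerEquiv m).surjective v
  have hj := j.isLt
  ext
  simp only [Equiv.symm_apply_apply, layerStep, Equiv.refl_apply, fin_val_add_one,
    layerEquiv_val]
  by_cases h : j.val = m - 1 <;> cases b <;> simp [h] <;> (try split_ifs) <;> omega

/-- A potential `p` for the crossings exists when their number is even. Relabelling layers by `p`
removes every crossing. -/
theorem isTwoCycles_layerGraph (hm : 3 ≤ m) (x p : Fin m → Bool)
    (hp : ∀ j, p (j + 1) = (p j ^^ x j)) : IsTwoCycles (layerGraph x) := by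
  let t : Bool × Fin m ≃ Bool × Fin m :=
    { toFun := fun v => (v.1 ^^ p v.2, v.2)
      invFun := fun v => (v.1 ^^ p v.2, v.2)
      left_inv := fun v => by simp
      right_inv := fun v => by simp }
  refine ⟨m, hm, rfl, nonempty_iso_cycleGraph_sum hm
    (((layerEquiv m).symm.trans t).trans (Equiv.boolProdEquivSum _)) fun v => ?_⟩
  obtain ⟨⟨b, j⟩, rfl⟩ := (layerEquiv m).surjective v
  simp only [Equiv.trans_apply, Equiv.symm_apply_apply, layerStep, t, Equiv.coe_fn_mk, hp]
  cases b <;> cases p j <;> cases x j <;> simp [Equiv.boolProdEquivSum]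

theorem isTwoCycles_layerGraph_flip (hm : 3 ≤ m) (i : Fin m) :
    IsTwoCycles (layerGraph fun j : Fin m => decide (j.val = m - 1) ^^ decide (j = i)) := by
  -- The potential changes just after `i` and again at the wrap-around. For `i = m - 1` the two
  -- crossings cancel and the potential is constantly `false`.
  refine isTwoCycles_layerGraph hm _ (fun j => decide (i.val < j.val)) fun j => ?_
  have hi := i.isLt
  have hj := j.isLt
  simp only [fin_val_add_one, Fin.ext_iff]
  by_cases h1 : j.val = m - 1 <;> by_cases h2 : j.val = i.val <;> simp [h1, h2] <;>
    first | omega | simp [← h2, h1]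

/-- Each edge slot depends on a single crossing bit. Here `3 ≤ m` matters: it excludes that `j = i +
1` and `i = j + 1` both hold. -/
theorem hasDegree_inputOfGraph_layerGraph (hm : 3 ≤ m) (c : Fin m → Bool) (e : EdgeSlot (2 * m)) :
    HasDegree 1 fun y : Fin m → Bool => inputOfGraph (layerGraph fun j => c j ^^ y j) e := by
  classical
  have key : ∃ (i : Fin m) (h : Bool → Bool), ∀ y : Fin m → Bool,
      inputOfGraph (layerGraph fun j => c j ^^ y j) e = h (y i) := by
    obtain ⟨e, he⟩ := e
    induction e with | _ u v =>
    obtain ⟨⟨a, i⟩, rfl⟩ := (layerEquiv m).surjective u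
    obtain ⟨⟨b, j⟩, rfl⟩ := (layerEquiv m).surjective v
    have hne : (a, i) ≠ (b, j) := by simpa using he
    simp only [inputOfGraph, layerGraph, successorGraph, mem_edgeSet, fromRel_adj, ne_eq,
      (layerEquiv m).injective.eq_iff, hne, not_false_eq_true, true_and,
      Equiv.symm_apply_apply, layerStep, Prod.mk.injEq]
    by_cases h : j = i + 1
    · have h' : i ≠ j + 1 := by
        subst h
        intro h
        have h1 := congrArg Fin.val h
        have hi := i.isLt
        rw [fin_val_add_one, fin_val_add_one] at h1
        split_ifs at h1 <;> omega
      exact ⟨i, fun t => decide (b = (a ^^ (c i ^^ t))), fun y => by simp [h', ← h]⟩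
    · exact ⟨j, fun t => decide (a = (b ^^ (c j ^^ t)) ∧ i = j + 1), fun y => by simp [h]⟩
  obtain ⟨i, h, hh⟩ := key
  simp only [hh]
  exact (HasDegree.coord i).map h

end Graphs

/-! ### Assembling the round lower bound -/

section LowerBound

theorem AMPCAlgorithm.Outputs.lookup_eq {S : ℝ} {ι : Type} [Fintype ι] {Δ : Set (ι → Bool)}
    {A : AMPCAlgorithm.{u} S Δ} {x : ι → Bool} {b : Bool} (h : A.Outputs x b) :
    lookup (A.store S x A.rounds) A.answerKey = {A.bit b} := by
  rw [h, lookup_singleton]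

/-- Few blocks can be sensitive for a deterministic algorithm. -/
theorem AMPCAlgorithm.card_sensitive_lt {S : ℝ} (hS : 1 < S) {ι κ : Type} [Fintype ι]
    [DecidableEq κ] {Δ : Set (ι → Bool)} (A : AMPCAlgorithm.{u} S Δ)
    {φ : (κ → Bool) → ι → Bool} (hφ : ∀ e, HasDegree 1 fun y => φ y e) {R : ℕ}
    (hR : A.rounds ≤ R) {U : Finset κ} (h0 : A.Outputs (φ fun _ => false) true)
    (h1 : ∀ i ∈ U, A.Outputs (φ fun j => decide (j = i)) false) :
    U.card < 4 * (⌊S⌋₊ ^ (2 * R)) ^ 2 := by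
  classical
  have hS1 : 1 ≤ ⌊S⌋₊ := Nat.le_floor (by exact_mod_cast hS.le)
  -- The polynomial is the indicator that the answer key holds exactly the bit `true`. It is `0` or
  -- `1` on all inputs, whatever the algorithm does there.
  have hdeg := degreeLE_mono (Nat.pow_le_pow_right hS1 (Nat.mul_le_mul_left 2 hR))
    (A.hasDegree_lookup_store (by linarith) A.rounds le_rfl A.answerKey fun M =>
      if M = {A.bit true} then 1 else 0)
  refine card_lt_four_mul_sq_of_sensitive (comp_mem_degreeLE hdeg hφ) (fun y => ?_)
    (Nat.one_le_pow _ _ hS1) ?_ fun i hi => ?_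
  · split_ifs <;> simp
  · simp [h0.lookup_eq]
  · simp [(h1 i hi).lookup_eq]

/-- A partial Boolean function with `m` disjoint sensitive blocks at some point is hard for
randomized algorithms with error `1 / 6`. -/
theorem RandomizedAMPC.two_thirds_mul_le {S : ℝ} (hS : 1 < S) {ι : Type} [Fintype ι] {m : ℕ}
    {Δ : Set (ι → Bool)} (A : RandomizedAMPC.{u, v} S Δ) {g : Δ → Bool} {R : ℕ}
    (hg : A.ComputesWithError g (1 / 6)) (hR : A.RoundsAtMost R)
    {φ : (Fin m → Bool) → ι → Bool} (hφ : ∀ e, HasDegree 1 fun y => φ y e)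
    (h0 : ∃ h : φ (fun _ => false) ∈ Δ, g ⟨_, h⟩ = true)
    (h1 : ∀ i, ∃ h : φ (fun j => decide (j = i)) ∈ Δ, g ⟨_, h⟩ = false) :
    2 / 3 * (m : ℝ) ≤ 4 * (((⌊S⌋₊ ^ (2 * R)) ^ 2 : ℕ) : ℝ) - 1 := by
  classical
  let E : Set A.Ω := {ω | (A.alg ω).Outputs (φ fun _ => false) true}
  let F : Fin m → Set A.Ω := fun i => {ω | (A.alg ω).Outputs (φ fun j => decide (j = i)) false}
  obtain ⟨hΔ0, hg0⟩ := h0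
  have hE : MeasurableSet E := A.measurableSet_outputs _ hΔ0 true
  have hF : ∀ i, MeasurableSet (F i) := fun i => A.measurableSet_outputs _ (h1 i).1 false
  have hEμ : 5 / 6 ≤ A.μ.real E := by
    have := hg ⟨_, hΔ0⟩
    rw [hg0] at this
    exact le_trans (by norm_num) this
  have hFμ : ∀ i, 5 / 6 ≤ A.μ.real (F i) := fun i => by
    obtain ⟨hΔ, hgi⟩ := h1 i
    have := hg ⟨_, hΔ⟩
    rw [hgi] at this
    exact le_trans (by norm_num) this
  -- The overlap is at least `5 / 6 + 5 / 6 - 1`.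
  have hEF : ∀ i, 2 / 3 ≤ A.μ.real (E ∩ F i) := fun i => by
    have h := measureReal_union_add_inter (μ := A.μ) (s := E) (hF i)
    have h' : A.μ.real (E ∪ F i) ≤ 1 := measureReal_le_one
    linarith [hEμ, hFμ i]
  have hint : ∀ i, Integrable ((E ∩ F i).indicator fun _ => (1 : ℝ)) A.μ := fun i =>
    (integrable_const 1).indicator (hE.inter (hF i))
  have hlow : 2 / 3 * (m : ℝ) ≤ ∫ ω, ∑ i, (E ∩ F i).indicator (fun _ => (1 : ℝ)) ω ∂A.μ := by
    rw [integral_finsetSum _ fun i _ => hint i]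
    calc 2 / 3 * (m : ℝ) = ∑ _i : Fin m, (2 / 3 : ℝ) := by simp [mul_comm]
      _ ≤ _ := Finset.sum_le_sum fun i _ => by
        rw [integral_indicator_const _ (hE.inter (hF i))]
        simpa using hEF i
  have hup : ∀ᵐ ω ∂A.μ, ∑ i, (E ∩ F i).indicator (fun _ => (1 : ℝ)) ω ≤
      4 * (((⌊S⌋₊ ^ (2 * R)) ^ 2 : ℕ) : ℝ) - 1 := by
    filter_upwards [hR] with ω hω
    have hpos : 0 < (⌊S⌋₊ ^ (2 * R)) ^ 2 :=
      pow_pos (pow_pos (Nat.floor_pos.2 hS.le) _) _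
    by_cases hωE : ω ∈ E
    · have h := (A.alg ω).card_sensitive_lt hS hφ hω (U := Finset.univ.filter fun i => ω ∈ F i)
        hωE fun i hi => (Finset.mem_filter.1 hi).2
      have h' : (((Finset.univ.filter fun i => ω ∈ F i).card + 1 : ℕ) : ℝ) ≤
        (4 * (⌊S⌋₊ ^ (2 * R)) ^ 2 : ℕ) := Nat.cast_le.2 h
      have hsum : ∑ i, (E ∩ F i).indicator (fun _ => (1 : ℝ)) ω =
          (Finset.univ.filter fun i => ω ∈ F i).card := by
        simp [Set.indicator_apply, hωE]
      rw [hsum]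
      push_cast at h' ⊢
      linarith
    · have hsum : ∑ i, (E ∩ F i).indicator (fun _ => (1 : ℝ)) ω = 0 := by
        simp [hωE]
      have : (1 : ℝ) ≤ ((⌊S⌋₊ ^ (2 * R)) ^ 2 : ℕ) := by exact_mod_cast hpos
      linarith
  refine hlow.trans ?_
  have := integral_mono_ae (integrable_finsetSum _ fun i _ => hint i)
    (integrable_const (μ := A.μ) _) hup
  simpa using this

/-- The sensitivity bound gives `n ≤ 12 * d ^ 2 - 3`. The cubic form absorbs the constant and, after
taking logarithms, gives exactly the stated inequality. -/
theorem le_eight_mul_pow_of_computes {n : ℕ} (hn : Even n) {S : ℝ} (hS : 1 < S)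
    (A : RandomizedAMPC.{u, v} S (cycleDomain n)) {R : ℕ}
    (hA : A.ComputesWithError (oneVsTwoCycle n) (1 / 6)) (hR : A.RoundsAtMost R) :
    n ≤ 8 * (⌊S⌋₊ ^ (2 * R)) ^ 3 := by
  have hd : 1 ≤ ⌊S⌋₊ ^ (2 * R) := Nat.one_le_pow _ _ (Nat.floor_pos.2 hS.le)
  obtain ⟨m, rfl⟩ := hn.two_dvd
  -- For `m ≤ 4` the bound is trivial as `n ≤ 8`. Larger `m` rules out `d = 1` below, and `d ≥ 2`
  -- gives `12 * d ^ 2 ≤ 8 * d ^ 3`.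
  rcases le_or_gt m 4 with hm | hm
  · nlinarith [Nat.one_le_pow 3 _ hd]
  have : NeZero m := ⟨by omega⟩
  have h := A.two_thirds_mul_le hS hA hR
    (φ := fun y => inputOfGraph (layerGraph fun j => decide (j.val = m - 1) ^^ y j))
    (hasDegree_inputOfGraph_layerGraph (by omega) _)
    (by
      have h1 := isOneCycle_layerGraph (m := m) (by omega)
      simp only [Bool.xor_false]
      exact ⟨Or.inl (by rwa [graphOfInput_inputOfGraph]),
        by simpa [oneVsTwoCycle, graphOfInput_inputOfGraph] using h1⟩)
    (fun i => by
      have h2 := isTwoCycles_layerGraph_flip (m := m) (by omega) i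
      exact ⟨Or.inr (by rwa [graphOfInput_inputOfGraph]),
        by simpa [oneVsTwoCycle, graphOfInput_inputOfGraph] using not_isOneCycle_of_isTwoCycles h2⟩)
  generalize ⌊S⌋₊ ^ (2 * R) = d at *
  have h' : 2 * m + 3 ≤ 12 * d ^ 2 := by
    have : (2 * m + 3 : ℝ) ≤ 12 * d ^ 2 := by
      push_cast at h
      linarith
    exact_mod_cast this
  rcases hd.eq_or_lt with rfl | hd
  · omega
  · have : d ^ 3 = d * d ^ 2 := by ring
    nlinarith [Nat.mul_le_mul_right (d ^ 2) hd]

theorem one_sixth_logb_sub_le_of_computes {n : ℕ} (hn : Even n) {S : ℝ} (hS : 1 < S)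
    (A : RandomizedAMPC.{u, v} S (cycleDomain n)) {R : ℕ}
    (hA : A.ComputesWithError (oneVsTwoCycle n) (1 / 6)) (hR : A.RoundsAtMost R) :
    1 / 6 * Real.logb S n - 1 / 2 * Real.logb S 2 ≤ R := by
  have h8 : Real.logb S 8 = 3 * Real.logb S 2 := by
    rw [show (8 : ℝ) = 2 ^ 3 by norm_num, Real.logb_pow]
    norm_num
  -- For `n = 0` the default value `Real.logb S 0 = 0` makes the left side nonpositive.
  rcases Nat.eq_zero_or_pos n with rfl | hpos
  · have := Real.logb_nonneg hS one_le_two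
    have hR0 : (0 : ℝ) ≤ R := R.cast_nonneg
    simp only [Nat.cast_zero, Real.logb_zero]
    linarith
  have h := le_eight_mul_pow_of_computes hn hS A hA hR
  have hle : (n : ℝ) ≤ 8 * S ^ (6 * R) := by
    calc (n : ℝ) ≤ 8 * ((⌊S⌋₊ : ℝ) ^ (2 * R)) ^ 3 := by exact_mod_cast h
      _ = 8 * (⌊S⌋₊ : ℝ) ^ (6 * R) := by ring
      _ ≤ _ := by
        gcongr
        exact Nat.floor_le (by linarith)
  have hlog := Real.logb_le_logb_of_le hS (by exact_mod_cast hpos) hle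
  rw [Real.logb_mul (by norm_num) (by positivity), h8, Real.logb_pow,
    Real.logb_self_eq_one hS] at hlog
  push_cast at hlog
  linarith

theorem one_twelfth_logb_le_of_computes {n : ℕ} (h64 : 64 ≤ n) (hn : Even n) {S : ℝ} (hS : 1 < S)
    (A : RandomizedAMPC.{u, v} S (cycleDomain n)) {R : ℕ}
    (hA : A.ComputesWithError (oneVsTwoCycle n) (1 / 6)) (hR : A.RoundsAtMost R) :
    1 / 12 * Real.logb S n ≤ R := by
  have h := one_sixth_logb_sub_le_of_computes hn hS A hA hR
  -- The threshold `64 = 2 ^ 6` is where the subtracted term is at most half of the main one.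
  have h2 : 6 * Real.logb S 2 ≤ Real.logb S n := by
    have := Real.logb_le_logb_of_le hS (by norm_num : (0 : ℝ) < 2 ^ 6)
      (show (2 : ℝ) ^ 6 ≤ n by norm_num; exact_mod_cast h64)
    rw [Real.logb_pow] at this
    exact_mod_cast this
  linarith

end LowerBound

theorem mainTheorem1 :
    (∀ n : ℕ, Even n → ∀ S : ℝ, 1 < S →
      ∀ (A : RandomizedAMPC.{u, v} S (cycleDomain n)) (R : ℕ),
        A.ComputesWithError (oneVsTwoCycle n) (1 / 6) → A.RoundsAtMost R →
          1 / 6 * Real.logb S n - 1 / 2 * Real.logb S 2 ≤ R) ∧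
    (∃ c : ℝ, 0 < c ∧ ∃ n₀ : ℕ, ∀ n : ℕ, n₀ ≤ n → Even n → ∀ S : ℝ, 1 < S →
      ∀ (A : RandomizedAMPC.{u, v} S (cycleDomain n)) (R : ℕ),
        A.ComputesWithError (oneVsTwoCycle n) (1 / 6) → A.RoundsAtMost R →
          c * Real.logb S n ≤ R) ∧
    (∃ c : ℝ, 0 < c ∧ ∃ n₀ : ℕ, ∀ n : ℕ, n₀ ≤ n → Even n →
      ∀ ε : ℝ, 0 < ε → ε < 1 →
      ∀ (A : RandomizedAMPC.{u, v} ((n : ℝ) ^ ε) (cycleDomain n)) (R : ℕ),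
        A.ComputesWithError (oneVsTwoCycle n) (1 / 6) → A.RoundsAtMost R →
          c * (1 / ε) ≤ R) := by
  refine ⟨fun n hn S hS A R hA hR => one_sixth_logb_sub_le_of_computes hn hS A hA hR,
    ⟨1 / 12, by norm_num, 64, fun n h64 hn S hS A R hA hR =>
      one_twelfth_logb_le_of_computes h64 hn hS A hA hR⟩,
    ⟨1 / 12, by norm_num, 64, fun n h64 hn ε hε _ A R hA hR => ?_⟩⟩
  have h1 : (1 : ℝ) < n := by exact_mod_cast (show 1 < n by omega)
  have h := one_twelfth_logb_le_of_computes h64 hn (Real.one_lt_rpow h1 hε) A hA hR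
  have hlog : Real.logb ((n : ℝ) ^ ε) n = 1 / ε := by
    have := (Real.log_pos h1).ne'
    rw [Real.logb, Real.log_rpow (by linarith)]
    field_simp
  rwa [hlog] at h
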